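/- Let $n\ge 1$, $0<\alpha<2$, and let $F$ be a finite-dimensional real inner product space with norm $|\cdot|$ (for instance $F=\mathbb R$, or $F=\mathbb R^N$ with the Euclidean norm). Let $u:\mathbb R^n\to F$ belong to $E=C^{1,1}_{loc}(\mathbb R^n)\cap L_\alpha$: that is, $u$ is continuously differentiable with locally Lipschitz derivative, and $$\int_{\mathbb R^n}\frac{|u(x)|}{1+|x|^{n+\alpha}}\,dx<\infty .$$ For such $u$ the fractional Laplacian is defined at every $x\in\mathbb R^n$ by the principal value $$(-\Delta)^{\alpha/2}u(x)=C_{n,\alpha}\lim_{\varepsilon\to0^+}\int_{|x-y|\ge\varepsilon}\frac{u(x)-u(y)}{|x-y|^{n+\alpha}}\,dy,\qquad C_{n,\alpha}=\frac{\alpha\,2^{\alpha-1}\,\Gamma\left(\frac{n+\alpha}{2}\right)}{\pi^{n/2}\,\Gamma\left(1-\frac{\alpha}{2}\right)} .$$ Suppose that $u$ solves the fractional Ginzburg–Landau equation $$(-\Delta)^{\alpha/2}u(x)=u(x)\,(1-|u(x)|^2)\qquad\text{for every }x\in\mathbb R^n,$$ and that $$\int_{\mathbb R^n}(1-|u|^2)^2\,dx<\infty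 .$$ Then $|u(x)|\le 1$ for every $x\in\mathbb R^n$. -/

import Mathlib

open MeasureTheory Filter Topology

noncomputable section

/-- The normalizing constant of the fractional Laplacian of order `α` on `ℝⁿ`,
`C(n, α) = α 2^(α-1) Γ((n+α)/2) / (π^(n/2) Γ(1-α/2))`, the one for which the operator has
Fourier symbol `|ξ|^α`. -/
def fracConst (n : ℕ) (α : ℝ) : ℝ :=
  α * (2 : ℝ) ^ (α - 1) * Real.Gamma (((n : ℝ) + α) / 2) /
    (Real.pi ^ ((n : ℝ) / 2) * Real.Gamma (1 - α / 2))

/-- `u ∈ C^{1,1}_loc`: `u` is continuously differentiable and its derivative is locally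
Lipschitz. -/
def IsC11Loc {n : ℕ} {F : Type*} [NormedAddCommGroup F] [NormedSpace ℝ F]
    (u : EuclideanSpace ℝ (Fin n) → F) : Prop :=
  ContDiff ℝ 1 u ∧ LocallyLipschitz (fderiv ℝ u)

/-- `u ∈ L_α`: `u` is locally integrable and `∫ |u(x)| / (1 + |x|^(n+α)) dx < ∞`. -/
def MemLAlpha {n : ℕ} {F : Type*} [NormedAddCommGroup F] (α : ℝ)
    (u : EuclideanSpace ℝ (Fin n) → F) : Prop :=
  LocallyIntegrable u volume ∧
    Integrable (fun x => ‖u x‖ / (1 + ‖x‖ ^ ((n : ℝ) + α))) volume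

/-- The class `E = C^{1,1}_loc ∩ L_α`. -/
def MemE {n : ℕ} {F : Type*} [NormedAddCommGroup F] [NormedSpace ℝ F] (α : ℝ)
    (u : EuclideanSpace ℝ (Fin n) → F) : Prop :=
  IsC11Loc u ∧ MemLAlpha α u

/-- The singular integral truncated at radius `ε`:
`C(n, α) ∫_{|x-y| ≥ ε} (u(x) - u(y)) / |x-y|^(n+α) dy`. -/
def truncFracLaplacian {n : ℕ} {F : Type*} [NormedAddCommGroup F] [NormedSpace ℝ F] (α ε : ℝ)
    (u : EuclideanSpace ℝ (Fin n) → F) (x : EuclideanSpace ℝ (Fin n)) : F :=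
  fracConst n α • ∫ y in {y | ε ≤ ‖x - y‖}, (‖x - y‖ ^ ((n : ℝ) + α))⁻¹ • (u x - u y)

/-- `(-Δ)^(α/2) u (x) = v`, the singular integral being taken in the principal value sense.
(For `u ∈ E` and `0 < α < 2` the truncated integrals converge absolutely and the limit exists
at every point.) -/
def HasFracLaplacianAt {n : ℕ} {F : Type*} [NormedAddCommGroup F] [NormedSpace ℝ F] (α : ℝ)
    (u : EuclideanSpace ℝ (Fin n) → F) (v : F) (x : EuclideanSpace ℝ (Fin n)) : Prop :=
  Tendsto (fun ε : ℝ => truncFracLaplacian α ε u x) (𝓝[>] 0) (𝓝 v)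

/-- `u` solves the fractional Ginzburg-Landau equation `(-Δ)^(α/2) u = u (1 - |u|²)` at every
point of `ℝⁿ`. -/
def IsGinzburgLandauSolution {n : ℕ} {F : Type*} [NormedAddCommGroup F] [NormedSpace ℝ F]
    (α : ℝ) (u : EuclideanSpace ℝ (Fin n) → F) : Prop :=
  ∀ x, HasFracLaplacianAt α u ((1 - ‖u x‖ ^ 2) • u x) x

end

/-! If `‖u x₀‖ > 1`, maximize `(‖u‖ - 1) w ^ k` over the ball of radius `R` about `x₀`, where `w = 1
- ‖y - x₀‖ ^ 2 / R ^ 2` and `k = n + 2`. At the maximum point put `m = ‖u‖ - 1` and `t = w`, so that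
`R t` is comparable to the distance to the sphere. Kato's inequality (`eventually_norm_le`) bounds
the truncated operator on `‖u‖` above by about `-m (m + 1) (m + 2) ≤ -m ^ 2`.

It is bounded below on two regions. For `‖h‖ < R t / 6`, maximality puts `‖u‖ - 1` below `m t ^ k
w⁻ᵏ`, whose linear part cancels by symmetry: the loss is `O(m (R t) ^ (-α))`. Farther out, the
finite energy and Young's inequality give a loss `O((R t) ^ (-(n / 2 + α)))`.

Multiplying `m ^ 2 ≤ C₁ m (R t) ^ (-α) + C₂ (R t) ^ (-(n / 2 + α))` by `t ^ (2 k)` absorbs the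
negative powers of `t`. The weighted maximum, at least `‖u x₀‖ - 1`, is then forced to zero as `R →
∞`. -/

section Radial

open Set

/-! ### Integrals of powers of the norm over balls and their complements. -/

theorem integrableOn_radial_iff {n : ℕ} [NeZero n] {S : Set ℝ} (hS : MeasurableSet S)
    (g : ℝ → ℝ) :
    IntegrableOn (fun h : EuclideanSpace ℝ (Fin n) => g ‖h‖) {h | ‖h‖ ∈ S} ↔
      IntegrableOn (fun y : ℝ => y ^ (n - 1) * g y) (Ioi 0 ∩ S) := by
  have hS' : MeasurableSet {h : EuclideanSpace ℝ (Fin n) | ‖h‖ ∈ S} := measurable_norm hS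
  have key := integrable_fun_norm_addHaar (volume : Measure (EuclideanSpace ℝ (Fin n)))
    (f := S.indicator g)
  rw [← integrable_indicator_iff hS']
  have e : {h : EuclideanSpace ℝ (Fin n) | ‖h‖ ∈ S}.indicator (fun h => g ‖h‖) =
      fun h => S.indicator g ‖h‖ := by
    ext h; simp [indicator]
  rw [e, key, inter_comm]
  simp only [finrank_euclideanSpace, Fintype.card_fin, smul_eq_mul]
  rw [IntegrableOn, IntegrableOn, ← Measure.restrict_restrict hS]
  refine Iff.trans ?_ (integrable_indicator_iff hS)
  congr! 1
  ext y
  by_cases hy : y ∈ S <;> simp [hy]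

theorem setIntegral_radial {n : ℕ} [NeZero n] {S : Set ℝ} (hS : MeasurableSet S) (g : ℝ → ℝ) :
    ∫ h in {h : EuclideanSpace ℝ (Fin n) | ‖h‖ ∈ S}, g ‖h‖ =
      n * volume.real (Metric.ball (0 : EuclideanSpace ℝ (Fin n)) 1) *
        ∫ y in Ioi 0 ∩ S, y ^ (n - 1) * g y := by
  have hS' : MeasurableSet {h : EuclideanSpace ℝ (Fin n) | ‖h‖ ∈ S} := measurable_norm hS
  have key := integral_fun_norm_addHaar (volume : Measure (EuclideanSpace ℝ (Fin n)))
    (S.indicator g)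
  rw [← integral_indicator hS']
  have e : {h : EuclideanSpace ℝ (Fin n) | ‖h‖ ∈ S}.indicator (fun h => g ‖h‖) =
      fun h => S.indicator g ‖h‖ := by
    ext h; simp [indicator]
  rw [e, key, inter_comm]
  simp only [finrank_euclideanSpace, Fintype.card_fin, smul_eq_mul, nsmul_eq_mul]
  rw [← Measure.restrict_restrict hS, ← integral_indicator hS, mul_assoc]
  congr! 3
  ext y
  by_cases hy : y ∈ S <;> simp [hy]

theorem pow_pred_mul_inv_rpow {n : ℕ} [NeZero n] {y : ℝ} (hy : 0 < y) (q : ℝ) :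
    y ^ (n - 1) * (y ^ q)⁻¹ = y ^ ((n : ℝ) - q - 1) := by
  rw [← Real.rpow_natCast, ← Real.rpow_neg hy.le, ← Real.rpow_add hy,
    Nat.cast_sub (Nat.one_le_iff_ne_zero.2 (NeZero.ne n))]
  congr 1
  push_cast
  ring

theorem integrableOn_inv_norm_rpow_far {n : ℕ} [NeZero n] {q r : ℝ} (hq : (n : ℝ) < q)
    (hr : 0 < r) :
    IntegrableOn (fun h : EuclideanSpace ℝ (Fin n) => (‖h‖ ^ q)⁻¹) {h | r ≤ ‖h‖} := by
  have hI : Ioi (0 : ℝ) ∩ Ici r = Ici r := inter_eq_right.2 fun y hy => hr.trans_le hy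
  refine (integrableOn_radial_iff (n := n) (S := Ici r) measurableSet_Ici
    (fun y => (y ^ q)⁻¹)).2 ?_
  rw [hI, integrableOn_Ici_iff_integrableOn_Ioi]
  refine (integrableOn_Ioi_rpow_of_lt (a := (n : ℝ) - q - 1) (by linarith) hr).congr_fun
    (fun y hy => (pow_pred_mul_inv_rpow (hr.trans hy) q).symm) measurableSet_Ioi

theorem setIntegral_inv_norm_rpow_far {n : ℕ} [NeZero n] {q r : ℝ} (hq : (n : ℝ) < q)
    (hr : 0 < r) :
    ∫ h in {h : EuclideanSpace ℝ (Fin n) | r ≤ ‖h‖}, (‖h‖ ^ q)⁻¹ =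
      n * volume.real (Metric.ball (0 : EuclideanSpace ℝ (Fin n)) 1) / (q - n) *
        r ^ ((n : ℝ) - q) := by
  have hI : Ioi (0 : ℝ) ∩ Ici r = Ici r := inter_eq_right.2 fun y hy => hr.trans_le hy
  refine (setIntegral_radial (n := n) (S := Ici r) measurableSet_Ici (fun y => (y ^ q)⁻¹)).trans ?_
  rw [hI, integral_Ici_eq_integral_Ioi, setIntegral_congr_fun measurableSet_Ioi
    (fun y hy => pow_pred_mul_inv_rpow (hr.trans hy) q),
    integral_Ioi_rpow_of_lt (by linarith) hr, sub_add_cancel]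
  have h1 : (n : ℝ) - q ≠ 0 := by linarith
  have h2 : q - (n : ℝ) ≠ 0 := by linarith
  rw [show (n : ℝ) - q = -(q - n) by ring, neg_div_neg_eq]
  ring

theorem integrableOn_inv_norm_rpow_near {n : ℕ} [NeZero n] {q r : ℝ} (hq : q < n)
    (hr : 0 < r) :
    IntegrableOn (fun h : EuclideanSpace ℝ (Fin n) => (‖h‖ ^ q)⁻¹) {h | ‖h‖ < r} := by
  refine (integrableOn_radial_iff (n := n) (S := Iio r) measurableSet_Iio
    (fun y => (y ^ q)⁻¹)).2 ?_
  rw [Ioi_inter_Iio]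
  have := (intervalIntegral.intervalIntegrable_rpow' (a := 0) (b := r)
    (r := (n : ℝ) - q - 1) (by linarith))
  rw [intervalIntegrable_iff_integrableOn_Ioo_of_le hr.le] at this
  exact this.congr_fun (fun y hy => (pow_pred_mul_inv_rpow hy.1 q).symm) measurableSet_Ioo

theorem setIntegral_inv_norm_rpow_near {n : ℕ} [NeZero n] {q r : ℝ} (hq : q < n)
    (hr : 0 < r) :
    ∫ h in {h : EuclideanSpace ℝ (Fin n) | ‖h‖ < r}, (‖h‖ ^ q)⁻¹ =
      n * volume.real (Metric.ball (0 : EuclideanSpace ℝ (Fin n)) 1) / (n - q) *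
        r ^ ((n : ℝ) - q) := by
  refine (setIntegral_radial (n := n) (S := Iio r) measurableSet_Iio (fun y => (y ^ q)⁻¹)).trans ?_
  rw [Ioi_inter_Iio, setIntegral_congr_fun measurableSet_Ioo
    (fun y hy => pow_pred_mul_inv_rpow hy.1 q), ← integral_Ioc_eq_integral_Ioo,
    ← intervalIntegral.integral_of_le hr.le, integral_rpow (Or.inl (by linarith)),
    sub_add_cancel, Real.zero_rpow (by linarith)]
  ring

end Radial

/-! ### Truncated integrals and Kato's inequality. -/

/-- The truncated fractional Laplacian in terms of increments. -/
theorem truncFracLaplacian_eq {n : ℕ} {F : Type*} [NormedAddCommGroup F] [NormedSpace ℝ F]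
    (α ε : ℝ) (u : EuclideanSpace ℝ (Fin n) → F) (x : EuclideanSpace ℝ (Fin n)) :
    truncFracLaplacian α ε u x =
      fracConst n α • ∫ h in {h : EuclideanSpace ℝ (Fin n) | ε ≤ ‖h‖},
        (‖h‖ ^ ((n : ℝ) + α))⁻¹ • (u x - u (x - h)) := by
  have hm : MeasurableSet {h : EuclideanSpace ℝ (Fin n) | ε ≤ ‖h‖} :=
    measurable_norm measurableSet_Ici
  have hm' : MeasurableSet {y : EuclideanSpace ℝ (Fin n) | ε ≤ ‖x - y‖} :=
    (measurable_const_sub x).norm measurableSet_Ici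
  rw [truncFracLaplacian, ← integral_indicator hm, ← integral_indicator hm',
    ← integral_sub_left_eq_self _ volume x]
  congr 2
  ext y
  simp [Set.indicator]

theorem fracConst_pos {n : ℕ} {α : ℝ} (h0 : 0 < α) (h2 : α < 2) : 0 < fracConst n α := by
  have h3 : 0 < Real.Gamma (((n : ℝ) + α) / 2) := Real.Gamma_pos_of_pos (by positivity)
  have h4 : 0 < Real.Gamma (1 - α / 2) := Real.Gamma_pos_of_pos (by linarith)
  have := Real.pi_pos
  unfold fracConst
  positivity

/-- Away from the singularity the kernel is dominated by the weight defining `MemLAlpha`, so the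
truncated integrals converge absolutely. -/
theorem one_add_norm_rpow_le {E : Type*} [NormedAddCommGroup E] {p ε : ℝ} (hp : 0 ≤ p)
    (hε : 0 < ε) (x : E) :
    ∃ C, 0 ≤ C ∧ ∀ h : E, ε ≤ ‖h‖ → (‖h‖ ^ p)⁻¹ ≤ C * (1 + ‖x - h‖ ^ p)⁻¹ := by
  refine ⟨(ε ^ p)⁻¹ + (‖x‖ / ε + 1) ^ p, by positivity, fun h hh => ?_⟩
  have hh0 : 0 < ‖h‖ := hε.trans_le hh
  have hp0 : 0 < ‖h‖ ^ p := by positivity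
  rw [← div_eq_mul_inv, le_div_iff₀ (by positivity), inv_mul_le_iff₀ hp0, mul_add]
  gcongr
  · rw [← div_eq_mul_inv, one_le_div (by positivity)]
    exact Real.rpow_le_rpow hε.le hh hp
  · rw [← Real.mul_rpow hh0.le (by positivity)]
    refine Real.rpow_le_rpow (norm_nonneg _) ?_ hp
    calc ‖x - h‖ ≤ ‖x‖ + ‖h‖ := norm_sub_le _ _
      _ ≤ ‖h‖ / ε * ‖x‖ + ‖h‖ := by
        gcongr
        exact le_mul_of_one_le_left (norm_nonneg _) ((one_le_div hε).2 hh)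
      _ = _ := by ring

theorem integrableOn_kernel_smul {n : ℕ} [NeZero n] {F : Type*} [NormedAddCommGroup F]
    [NormedSpace ℝ F] {α ε : ℝ} (hα : 0 < α) (hε : 0 < ε)
    {u : EuclideanSpace ℝ (Fin n) → F} (hc : Continuous u) (hu : MemLAlpha α u)
    (x : EuclideanSpace ℝ (Fin n)) :
    IntegrableOn (fun h => (‖h‖ ^ ((n : ℝ) + α))⁻¹ • u (x - h)) {h | ε ≤ ‖h‖} := by
  obtain ⟨C, hC, hCb⟩ := one_add_norm_rpow_le (p := (n : ℝ) + α) (by positivity) hε x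
  have h1 := (hu.2.comp_sub_left x).const_mul C
  refine (h1.integrableOn (s := {h | ε ≤ ‖h‖})).mono' ?_ ?_
  · refine Measurable.aestronglyMeasurable ?_ |>.smul
      (hc.comp (continuous_const.sub continuous_id)).aestronglyMeasurable
    fun_prop
  · refine (ae_restrict_iff' (measurable_norm measurableSet_Ici)).2 (ae_of_all _ fun h hh => ?_)
    rw [norm_smul, Real.norm_of_nonneg (by positivity)]
    calc _ ≤ C * (1 + ‖x - h‖ ^ ((n : ℝ) + α))⁻¹ * ‖u (x - h)‖ := by
          gcongr; exact hCb h hh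
      _ = _ := by ring

theorem integrableOn_kernel_smul_sub {n : ℕ} [NeZero n] {F : Type*} [NormedAddCommGroup F]
    [NormedSpace ℝ F] {α ε : ℝ} (hα : 0 < α) (hε : 0 < ε)
    {u : EuclideanSpace ℝ (Fin n) → F} (hc : Continuous u) (hu : MemLAlpha α u)
    (x : EuclideanSpace ℝ (Fin n)) :
    IntegrableOn (fun h => (‖h‖ ^ ((n : ℝ) + α))⁻¹ • (u x - u (x - h))) {h | ε ≤ ‖h‖} := by
  simp only [smul_sub]
  exact (Integrable.smul_const (integrableOn_inv_norm_rpow_far (by linarith) hε) _).sub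
    (integrableOn_kernel_smul hα hε hc hu x)

theorem MemLAlpha.norm {n : ℕ} {F : Type*} [NormedAddCommGroup F] {α : ℝ}
    {u : EuclideanSpace ℝ (Fin n) → F} (hu : MemLAlpha α u) : MemLAlpha α (fun x => ‖u x‖) := by
  refine ⟨fun x => (hu.1 x).norm, ?_⟩
  simpa only [norm_norm] using hu.2

/-- Kato's inequality for the modulus of a solution, at the level of truncated integrals. -/
theorem IsGinzburgLandauSolution.eventually_norm_le {n : ℕ} [NeZero n] {F : Type*}
    [NormedAddCommGroup F] [InnerProductSpace ℝ F] [CompleteSpace F] {α : ℝ} (hα : 0 < α)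
    (hα2 : α < 2) {u : EuclideanSpace ℝ (Fin n) → F} (hc : Continuous u) (hL : MemLAlpha α u)
    (hu : IsGinzburgLandauSolution α u) {x : EuclideanSpace ℝ (Fin n)} (hx : 0 < ‖u x‖)
    {η : ℝ} (hη : 0 < η) :
    ∀ᶠ ε in 𝓝[>] (0 : ℝ), fracConst n α * ∫ h in {h : EuclideanSpace ℝ (Fin n) | ε ≤ ‖h‖},
        (‖h‖ ^ ((n : ℝ) + α))⁻¹ * (‖u x‖ - ‖u (x - h)‖) <
      ‖u x‖ * (1 - ‖u x‖ ^ 2) + η := by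
  have h1 : Tendsto (fun ε : ℝ => inner ℝ (u x) (truncFracLaplacian α ε u x)) (𝓝[>] 0)
      (𝓝 (inner ℝ (u x) ((1 - ‖u x‖ ^ 2) • u x))) := tendsto_const_nhds.inner (hu x)
  have h2 : inner ℝ (u x) ((1 - ‖u x‖ ^ 2) • u x) <
      ‖u x‖ * (‖u x‖ * (1 - ‖u x‖ ^ 2) + η) := by
    rw [real_inner_smul_right, real_inner_self_eq_norm_sq]
    nlinarith
  filter_upwards [h1.eventually_lt_const h2, self_mem_nhdsWithin] with ε hε (hε0 : 0 < ε)
  refine lt_of_mul_lt_mul_left (lt_of_le_of_lt ?_ hε) hx.le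
  rw [truncFracLaplacian_eq, real_inner_smul_right,
    ← integral_inner (integrableOn_kernel_smul_sub hα hε0 hc hL x), mul_left_comm]
  refine mul_le_mul_of_nonneg_left ?_ (fracConst_pos hα hα2).le
  rw [← integral_const_mul]
  refine integral_mono
    ((integrableOn_kernel_smul_sub hα hε0 hc.norm hL.norm x).const_mul _)
    ((integrableOn_kernel_smul_sub hα hε0 hc hL x).const_inner _) fun h => ?_
  simp only
  rw [real_inner_smul_right, inner_sub_right, real_inner_self_eq_norm_sq, mul_left_comm]
  refine mul_le_mul_of_nonneg_left ?_ (by positivity)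
  -- Cauchy–Schwarz gives `⟪u x, u x - u y⟫ ≥ ‖u x‖ (‖u x‖ - ‖u y‖)`.
  have := real_inner_le_norm (u x) (u (x - h))
  nlinarith

/-! ### Expansion of the barrier. -/

theorem exists_inv_one_sub_pow_le (k : ℕ) :
    ∃ C : ℝ, 0 ≤ C ∧ ∀ s : ℝ, |s| ≤ 1 / 2 → ((1 - s) ^ k)⁻¹ ≤ 1 + k * s + C * s ^ 2 := by
  induction k with
  | zero => exact ⟨0, le_rfl, fun s _ => by simp⟩
  | succ k ih =>
    obtain ⟨C, hC, h⟩ := ih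
    refine ⟨2 + 2 * k + 2 * C, by positivity, fun s hs => ?_⟩
    obtain ⟨hs1, hs2⟩ := abs_le.1 hs
    have h1 : (1 - s)⁻¹ ≤ 1 + s + 2 * s ^ 2 := by
      rw [inv_le_iff_one_le_mul₀ (by linarith)]
      nlinarith [mul_nonneg (sq_nonneg s) (by linarith : 0 ≤ 1 - 2 * s)]
    have h2 : (0 : ℝ) ≤ ((1 - s) ^ k)⁻¹ := inv_nonneg.2 (pow_nonneg (by linarith) _)
    rw [pow_succ, mul_inv]
    refine (mul_le_mul (h s hs) h1 (inv_nonneg.2 (by linarith)) (h2.trans (h s hs))).trans ?_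
    have e1 : 0 ≤ s ^ 2 * (k * (1 - 2 * s)) :=
      mul_nonneg (sq_nonneg _) (mul_nonneg k.cast_nonneg (by linarith))
    have e2 : 0 ≤ s ^ 2 * (C * ((1 / 2 - s) * (1 + s) + 1 / 2 * (1 - s))) :=
      mul_nonneg (sq_nonneg _) (mul_nonneg hC (by nlinarith))
    push_cast
    nlinarith [e1, e2, mul_nonneg (sq_nonneg s) hC,
      mul_nonneg (sq_nonneg s) (mul_nonneg hC (by nlinarith : 0 ≤ 1 / 4 - s ^ 2))]

/-- Second order expansion of the barrier `(1 - |z|² / R²)⁻ᵏ`, uniform at the scale of the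
distance to the boundary. -/
theorem exists_barrier_bound {E : Type*} [NormedAddCommGroup E] [InnerProductSpace ℝ E] (k : ℕ) :
    ∃ C : ℝ, 0 ≤ C ∧ ∀ (R : ℝ) (z : E), 0 < R → ‖z‖ ≤ R → 0 < 1 - ‖z‖ ^ 2 / R ^ 2 →
      ∃ b : E, ∀ h : E, ‖h‖ < R * (1 - ‖z‖ ^ 2 / R ^ 2) / 6 →
        0 < 1 - ‖z - h‖ ^ 2 / R ^ 2 ∧
        (1 - ‖z‖ ^ 2 / R ^ 2) ^ k * ((1 - ‖z - h‖ ^ 2 / R ^ 2) ^ k)⁻¹ ≤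
          1 + inner ℝ b h + C / (R * (1 - ‖z‖ ^ 2 / R ^ 2)) ^ 2 * ‖h‖ ^ 2 := by
  obtain ⟨C, hC, hb⟩ := exists_inv_one_sub_pow_le k
  refine ⟨k + 9 * C, by positivity, fun R z hR hz ht => ?_⟩
  have ht1 : 1 - ‖z‖ ^ 2 / R ^ 2 ≤ 1 := sub_le_self _ (by positivity)
  generalize htt : 1 - ‖z‖ ^ 2 / R ^ 2 = t at ht ht1 ⊢
  refine ⟨(-(2 * k / (R ^ 2 * t))) • z, fun h hh => ?_⟩
  have hzh : |inner ℝ z h| ≤ R * ‖h‖ :=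
    (abs_real_inner_le_norm z h).trans (mul_le_mul_of_nonneg_right hz (norm_nonneg _))
  have hhn := norm_nonneg h
  have hhR : ‖h‖ ≤ R := by nlinarith
  -- Chosen so that the weight at `z - h` is `t (1 - s)`. As `|s| ≤ 3 ‖h‖ / (R t)`, the radius `R t
  -- / 6` is what ensures `|s| ≤ 1 / 2`.
  set s : ℝ := (‖h‖ ^ 2 - 2 * inner ℝ z h) / (R ^ 2 * t) with hs
  have hs3 : |s| ≤ 3 * ‖h‖ / (R * t) := by
    rw [hs, abs_div, abs_of_pos (by positivity : 0 < R ^ 2 * t),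
      div_le_div_iff₀ (by positivity) (by positivity)]
    have : |‖h‖ ^ 2 - 2 * inner ℝ z h| ≤ 3 * R * ‖h‖ := by
      obtain ⟨h1, h2⟩ := abs_le.1 hzh
      rw [abs_le]
      constructor <;> nlinarith
    calc _ ≤ 3 * R * ‖h‖ * (R * t) := by gcongr
      _ = _ := by ring
  have hs2 : |s| ≤ 1 / 2 := by
    refine hs3.trans ?_
    rw [div_le_iff₀ (by positivity)]
    linarith
  have hst : 1 - ‖z - h‖ ^ 2 / R ^ 2 = t * (1 - s) := by
    have : t * (1 - s) = t - (‖h‖ ^ 2 - 2 * inner ℝ z h) / R ^ 2 := by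
      rw [hs]
      field_simp
    rw [norm_sub_sq_real, this, ← htt]
    ring
  have hs1 : 0 < 1 - s := by linarith [(abs_le.1 hs2).2]
  rw [hst]
  refine ⟨by positivity, ?_⟩
  rw [mul_pow, mul_inv, mul_inv_cancel_left₀ (by positivity)]
  refine (hb s hs2).trans ?_
  have hsq : s ^ 2 ≤ 9 * ‖h‖ ^ 2 / (R * t) ^ 2 := by
    rw [← sq_abs]
    refine (pow_le_pow_left₀ (abs_nonneg _) hs3 2).trans_eq ?_
    ring
  have hlin : k * s ≤ inner ℝ ((-(2 * k / (R ^ 2 * t))) • z) h +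
      k * (‖h‖ ^ 2 / (R * t) ^ 2) := by
    have : ‖h‖ ^ 2 / (R ^ 2 * t) ≤ ‖h‖ ^ 2 / (R * t) ^ 2 := by
      gcongr
      rw [mul_pow]
      gcongr
      nlinarith
    have := mul_le_mul_of_nonneg_left this (k.cast_nonneg (α := ℝ))
    rw [real_inner_smul_left]
    calc k * s = -(2 * k / (R ^ 2 * t)) * inner ℝ z h + k * (‖h‖ ^ 2 / (R ^ 2 * t)) := by
          rw [hs]; ring
      _ ≤ _ := by linarith
  calc 1 + k * s + C * s ^ 2
      ≤ 1 + (inner ℝ ((-(2 * k / (R ^ 2 * t))) • z) h + k * (‖h‖ ^ 2 / (R * t) ^ 2)) +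
        C * (9 * ‖h‖ ^ 2 / (R * t) ^ 2) := by gcongr
    _ = _ := by ring

/-! ### Lower bounds for the near and far kernel integrals. -/

section Estimates

variable {n : ℕ} [NeZero n] {α r : ℝ} {v : EuclideanSpace ℝ (Fin n) → ℝ}

/-- The linear term is odd and integrates to zero over the annulus. The quadratic one leaves the
integrable singularity `‖h‖ ^ (2 - α - n)`, so the bound does not depend on `ε`. -/
theorem setIntegral_kernel_annulus_ge (hα : 0 < α) (hα2 : α < 2) (hc : Continuous v)
    (hL : MemLAlpha α v) {x b : EuclideanSpace ℝ (Fin n)} {D ε : ℝ} (hD : 0 ≤ D) (hε : 0 < ε)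
    (hr : 0 < r)
    (hv : ∀ h, ‖h‖ < r → v (x - h) - v x ≤ inner ℝ b h + D * ‖h‖ ^ 2) :
    -(D * (n * volume.real (Metric.ball (0 : EuclideanSpace ℝ (Fin n)) 1) / (2 - α) *
        r ^ (2 - α))) ≤
      ∫ h in {h : EuclideanSpace ℝ (Fin n) | ε ≤ ‖h‖ ∧ ‖h‖ < r},
        (‖h‖ ^ ((n : ℝ) + α))⁻¹ * (v x - v (x - h)) := by
  set A := {h : EuclideanSpace ℝ (Fin n) | ε ≤ ‖h‖ ∧ ‖h‖ < r} with hA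
  have hAm : MeasurableSet A :=
    (measurable_norm measurableSet_Ici).inter (measurable_norm measurableSet_Iio)
  have hA1 : A ⊆ {h | ε ≤ ‖h‖} := fun h hh => hh.1
  have hA2 : A ⊆ {h | ‖h‖ < r} := fun h hh => hh.2
  have hq : (n : ℝ) - (2 - α) < n := by linarith
  have hnear := integrableOn_inv_norm_rpow_near (n := n) hq hr
  have hlin : IntegrableOn (fun h : EuclideanSpace ℝ (Fin n) =>
      (‖h‖ ^ ((n : ℝ) + α))⁻¹ * inner ℝ b h) A := by
    have hK := (integrableOn_inv_norm_rpow_far (n := n) (q := (n : ℝ) + α) (by linarith)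
      hε).mono_set hA1
    refine (hK.mul_const (‖b‖ * r)).mono' (Measurable.aestronglyMeasurable (by fun_prop)) ?_
    refine (ae_restrict_iff' hAm).2 (ae_of_all _ fun h hh => ?_)
    rw [norm_mul, Real.norm_of_nonneg (by positivity)]
    gcongr
    exact (abs_real_inner_le_norm b h).trans (by gcongr; exact hh.2.le)
  have hlin_neg : IntegrableOn (fun h : EuclideanSpace ℝ (Fin n) =>
      -((‖h‖ ^ ((n : ℝ) + α))⁻¹ * inner ℝ b h)) A := hlin.neg
  have hodd : ∫ h in A, (‖h‖ ^ ((n : ℝ) + α))⁻¹ * inner ℝ b h = 0 := by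
    rw [← integral_indicator hAm]
    have h1 := integral_neg_eq_self (A.indicator fun h : EuclideanSpace ℝ (Fin n) =>
      (‖h‖ ^ ((n : ℝ) + α))⁻¹ * inner ℝ b h) volume
    have h2 : (fun h => (A.indicator fun h : EuclideanSpace ℝ (Fin n) =>
        (‖h‖ ^ ((n : ℝ) + α))⁻¹ * inner ℝ b h) (-h)) = fun h =>
        -(A.indicator fun h : EuclideanSpace ℝ (Fin n) =>
        (‖h‖ ^ ((n : ℝ) + α))⁻¹ * inner ℝ b h) h := by
      ext h
      simp [Set.indicator, hA]
      split_ifs <;> simp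
    rw [h2, integral_neg] at h1
    linarith
  have hmono : ∫ h in A, (‖h‖ ^ ((n : ℝ) - (2 - α)))⁻¹ ≤
      n * volume.real (Metric.ball (0 : EuclideanSpace ℝ (Fin n)) 1) / (2 - α) *
        r ^ (2 - α) := by
    refine (setIntegral_mono_set hnear (ae_of_all _ fun h => by positivity)
      (LE.le.eventuallyLE hA2)).trans_eq ?_
    rw [setIntegral_inv_norm_rpow_near hq hr, sub_sub_cancel]
  calc _ ≤ -(D * ∫ h in A, (‖h‖ ^ ((n : ℝ) - (2 - α)))⁻¹) := by gcongr
    _ = ∫ h in A, (-((‖h‖ ^ ((n : ℝ) + α))⁻¹ * inner ℝ b h) -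
        D * (‖h‖ ^ ((n : ℝ) - (2 - α)))⁻¹) := by
      rw [integral_sub hlin_neg ((hnear.mono_set hA2).const_mul D), integral_neg, hodd,
        integral_const_mul, neg_zero, zero_sub]
    _ ≤ _ := by
      refine setIntegral_mono_on (hlin_neg.sub ((hnear.mono_set hA2).const_mul D))
        ((integrableOn_kernel_smul_sub hα hε hc hL x).mono_set hA1) hAm fun h hh => ?_
      have hh0 : 0 < ‖h‖ := hε.trans_le hh.1
      have e : (‖h‖ ^ ((n : ℝ) - (2 - α)))⁻¹ = (‖h‖ ^ ((n : ℝ) + α))⁻¹ * ‖h‖ ^ 2 := by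
        rw [← Real.rpow_natCast, ← Real.rpow_neg hh0.le, ← Real.rpow_neg hh0.le,
          ← Real.rpow_add hh0]
        congr 1
        push_cast
        ring
      have hK : 0 ≤ (‖h‖ ^ ((n : ℝ) + α))⁻¹ := by positivity
      rw [e]
      calc _ = (‖h‖ ^ ((n : ℝ) + α))⁻¹ * -(inner ℝ b h + D * ‖h‖ ^ 2) := by ring
        _ ≤ _ := mul_le_mul_of_nonneg_left (by linarith [hv h hh.2]) hK

/-- Only points with `v (x - h) > v x` contribute negatively. There Young's inequality `K s ≤ l K ^
2 / 2 + s ^ 2 / (2 l)` is used with `l = r ^ (n / 2 + α)`: since `∫ K ^ 2` is a multiple of `l⁻²`,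
both terms have size `l⁻¹`. -/
theorem setIntegral_kernel_far_ge (hα : 0 < α) (hc : Continuous v)
    (hL : MemLAlpha α v) {x : EuclideanSpace ℝ (Fin n)} (hr : 0 < r)
    {G : EuclideanSpace ℝ (Fin n) → ℝ} (hG0 : ∀ y, 0 ≤ G y) (hG : Integrable G)
    (hvG : ∀ y, v x ≤ v y → (v y - v x) ^ 2 ≤ G y) :
    -((n * volume.real (Metric.ball (0 : EuclideanSpace ℝ (Fin n)) 1) / (n + 2 * α) +
        ∫ y, G y) / 2 * r ^ (-((n : ℝ) / 2 + α))) ≤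
      ∫ h in {h : EuclideanSpace ℝ (Fin n) | r ≤ ‖h‖},
        (‖h‖ ^ ((n : ℝ) + α))⁻¹ * (v x - v (x - h)) := by
  set A := {h : EuclideanSpace ℝ (Fin n) | r ≤ ‖h‖} with hA
  have hAm : MeasurableSet A := measurable_norm measurableSet_Ici
  set l := r ^ ((n : ℝ) / 2 + α) with hl
  have hl0 : 0 < l := by positivity
  have hq : (n : ℝ) < 2 * (n + α) := by linarith [n.cast_nonneg (α := ℝ)]
  have hfar := integrableOn_inv_norm_rpow_far (n := n) hq hr
  have hfar_neg : IntegrableOn (fun h : EuclideanSpace ℝ (Fin n) =>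
      -(l / 2 * (‖h‖ ^ (2 * ((n : ℝ) + α)))⁻¹)) A := (hfar.const_mul _).neg
  have hGx := hG.comp_sub_left x
  have hGA : ∫ h in A, G (x - h) ≤ ∫ y, G y := by
    rw [← integral_sub_left_eq_self G volume x]
    exact setIntegral_le_integral hGx (ae_of_all _ fun h => hG0 _)
  have hrl : r ^ ((n : ℝ) - 2 * (n + α)) = l⁻¹ * l⁻¹ := by
    rw [hl, ← Real.rpow_neg hr.le, ← Real.rpow_add hr]
    congr 1
    ring
  calc _ ≤ -(l / 2 * ∫ h in A, (‖h‖ ^ (2 * ((n : ℝ) + α)))⁻¹) -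
          l⁻¹ / 2 * ∫ h in A, G (x - h) := by
        rw [setIntegral_inv_norm_rpow_far hq hr, hrl, Real.rpow_neg hr.le, ← hl,
          show 2 * ((n : ℝ) + α) - n = n + 2 * α by ring]
        have : l⁻¹ / 2 * ∫ h in A, G (x - h) ≤ l⁻¹ / 2 * ∫ y, G y := by gcongr
        refine le_trans (le_of_eq ?_) (sub_le_sub_left this _)
        field_simp
        ring
    _ = ∫ h in A, (-(l / 2 * (‖h‖ ^ (2 * ((n : ℝ) + α)))⁻¹) - l⁻¹ / 2 * G (x - h)) := by
      rw [integral_sub hfar_neg (hGx.const_mul _).integrableOn, integral_neg,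
        integral_const_mul, integral_const_mul]
    _ ≤ _ := by
      refine setIntegral_mono_on (hfar_neg.sub (hGx.const_mul _).integrableOn)
        (integrableOn_kernel_smul_sub hα hr hc hL x) hAm fun h hh => ?_
      have hh0 : 0 < ‖h‖ := hr.trans_le hh
      rw [mul_comm 2, Real.rpow_mul hh0.le, Real.rpow_ofNat, ← inv_pow]
      have hK : 0 ≤ (‖h‖ ^ ((n : ℝ) + α))⁻¹ := by positivity
      generalize (‖h‖ ^ ((n : ℝ) + α))⁻¹ = K at hK
      rcases le_total (v x) (v (x - h)) with hle | hle
      · have h1 : l⁻¹ / 2 * (v (x - h) - v x) ^ 2 ≤ l⁻¹ / 2 * G (x - h) := by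
          gcongr; exact hvG _ hle
        have h2 : 0 ≤ l⁻¹ / 2 * (l * K - (v (x - h) - v x)) ^ 2 := by positivity
        have h3 : l⁻¹ / 2 * (l * K - (v (x - h) - v x)) ^ 2 = l / 2 * K ^ 2 +
            K * (v x - v (x - h)) + l⁻¹ / 2 * (v (x - h) - v x) ^ 2 := by
          field_simp
          ring
        linarith
      · have h1 : 0 ≤ K * (v x - v (x - h)) := mul_nonneg hK (by linarith)
        have h2 : 0 ≤ l / 2 * K ^ 2 := by positivity
        have h3 : 0 ≤ l⁻¹ / 2 * G (x - h) := mul_nonneg (by positivity) (hG0 _)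
        linarith

theorem pow_mul_rpow_neg_le {t R β : ℝ} {j : ℕ} (ht : 0 < t) (ht1 : t ≤ 1) (hR : 1 ≤ R)
    (hj : β ≤ j) (hβ : α ≤ β) : t ^ j * (R * t) ^ (-β) ≤ R ^ (-α) := by
  rw [Real.mul_rpow (by linarith) ht.le, mul_left_comm, ← Real.rpow_natCast, ← Real.rpow_add ht]
  calc _ ≤ R ^ (-β) * 1 := by
        gcongr
        exact Real.rpow_le_one ht.le ht1 (by linarith)
    _ ≤ _ := by
        rw [mul_one]
        exact Real.rpow_le_rpow_of_exponent_le hR (by linarith)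

end Estimates

/-! ### The weighted maximum and the conclusion. -/

/-- The value of a solution at a maximum point of the modulus weighted by a power of the distance
to the boundary of a ball. -/
theorem IsGinzburgLandauSolution.exists_sq_le_at_weighted_max {n : ℕ} [NeZero n] {F : Type*}
    [NormedAddCommGroup F] [InnerProductSpace ℝ F] [CompleteSpace F] {α : ℝ} (hα : 0 < α)
    (hα2 : α < 2) {u : EuclideanSpace ℝ (Fin n) → F} (hc : Continuous u) (hL : MemLAlpha α u)
    (hu : IsGinzburgLandauSolution α u)
    (hint : Integrable (fun x => (1 - ‖u x‖ ^ 2) ^ 2)) (k : ℕ) :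
    ∃ C₁ C₂ : ℝ, 0 ≤ C₁ ∧ 0 ≤ C₂ ∧ ∀ (R t : ℝ) (x₀ x : EuclideanSpace ℝ (Fin n)), 0 < R →
      t = 1 - ‖x - x₀‖ ^ 2 / R ^ 2 → 0 < t → 1 < ‖u x‖ →
      (∀ y, 0 < 1 - ‖y - x₀‖ ^ 2 / R ^ 2 →
        (‖u y‖ - 1) * (1 - ‖y - x₀‖ ^ 2 / R ^ 2) ^ k ≤ (‖u x‖ - 1) * t ^ k) →
      (‖u x‖ - 1) ^ 2 ≤ C₁ * (‖u x‖ - 1) * (R * t) ^ (-α) +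
        C₂ * (R * t) ^ (-((n : ℝ) / 2 + α)) := by
  obtain ⟨C, hC, hbar⟩ := exists_barrier_bound (E := EuclideanSpace ℝ (Fin n)) k
  have hc0 : 0 < fracConst n α := fracConst_pos hα hα2
  set V := volume.real (Metric.ball (0 : EuclideanSpace ℝ (Fin n)) 1) with hV
  have hV0 : 0 ≤ V := measureReal_nonneg
  set I := ∫ y, (1 - ‖u y‖ ^ 2) ^ 2 with hI
  have hI0 : 0 ≤ I := integral_nonneg fun y => sq_nonneg _
  refine ⟨fracConst n α * (C * (n * V / (2 - α)) * (1 / 6 : ℝ) ^ (2 - α)),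
    fracConst n α * ((n * V / (n + 2 * α) + I) / 2 * (1 / 6 : ℝ) ^ (-((n : ℝ) / 2 + α))),
    ?_, by positivity, fun R t x₀ x hR ht ht0 hx hmax => ?_⟩
  · have : 0 < 2 - α := by linarith
    positivity
  have hm : 0 < ‖u x‖ - 1 := by linarith
  have hz : ‖x - x₀‖ ≤ R := by
    have h1 : ‖x - x₀‖ ^ 2 / R ^ 2 < 1 := by linarith
    rw [div_lt_one (by positivity)] at h1
    exact (lt_of_pow_lt_pow_left₀ 2 hR.le h1).le
  obtain ⟨b, hb⟩ := hbar R (x - x₀) hR hz (ht ▸ ht0)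
  rw [← ht] at hb
  have hd : 0 < R * t := by positivity
  have hr : 0 < R * t / 6 := by positivity
  have hvb : ∀ h, ‖h‖ < R * t / 6 → ‖u (x - h)‖ - ‖u x‖ ≤
      inner ℝ ((‖u x‖ - 1) • b) h + (‖u x‖ - 1) * (C / (R * t) ^ 2) * ‖h‖ ^ 2 := by
    intro h hh
    obtain ⟨h1, h2⟩ := hb h hh
    rw [show x - x₀ - h = x - h - x₀ by abel] at h1 h2
    have h3 := hmax (x - h) h1
    rw [← le_div_iff₀ (by positivity), div_eq_mul_inv, mul_assoc] at h3
    have h4 := h3.trans (mul_le_mul_of_nonneg_left h2 hm.le)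
    rw [real_inner_smul_left]
    linarith
  have hnear := fun ε (hε : 0 < ε) => setIntegral_kernel_annulus_ge hα hα2 hc.norm hL.norm
    (x := x) (b := (‖u x‖ - 1) • b) (D := (‖u x‖ - 1) * (C / (R * t) ^ 2)) (by positivity)
    hε hr hvb
  have hfar := setIntegral_kernel_far_ge hα hc.norm hL.norm (x := x) hr
    (G := fun y => (1 - ‖u y‖ ^ 2) ^ 2) (fun y => sq_nonneg _) hint (by
      intro y hy
      rw [show (1 - ‖u y‖ ^ 2) ^ 2 = (‖u y‖ ^ 2 - 1) ^ 2 by ring]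
      -- Since `‖u y‖ ≥ ‖u x‖ > 1`, one has `‖u y‖ - ‖u x‖ ≤ ‖u y‖ ^ 2 - 1`.
      refine pow_le_pow_left₀ (by linarith) ?_ 2
      nlinarith)
  rw [← hV] at hnear hfar
  rw [← hI] at hfar
  set N := (‖u x‖ - 1) * (C / (R * t) ^ 2) * (n * V / (2 - α) * (R * t / 6) ^ (2 - α)) with hN
  set P := (n * V / (n + 2 * α) + I) / 2 * (R * t / 6) ^ (-((n : ℝ) / 2 + α)) with hP
  have hmain : fracConst n α * (-N - P) ≤ ‖u x‖ * (1 - ‖u x‖ ^ 2) := by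
    -- Both lower bounds are independent of `ε`, so one small `ε` per `η` suffices and no principal
    -- value of `‖u‖` is needed.
    refine le_of_forall_pos_le_add fun η hη => ?_
    obtain ⟨ε, hε, hε0, hεr⟩ := ((hu.eventually_norm_le hα hα2 hc hL (x := x) (by linarith)
      hη).and (Ioo_mem_nhdsGT hr)).exists
    refine le_trans (mul_le_mul_of_nonneg_left ?_ hc0.le) hε.le
    have hunion : {h : EuclideanSpace ℝ (Fin n) | ε ≤ ‖h‖} =
        {h | ε ≤ ‖h‖ ∧ ‖h‖ < R * t / 6} ∪ {h | R * t / 6 ≤ ‖h‖} := by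
      ext h
      simp only [Set.mem_ofPred_eq, Set.mem_union]
      constructor
      · intro hh
        exact (lt_or_ge ‖h‖ (R * t / 6)).imp (fun h' => ⟨hh, h'⟩) id
      · rintro (hh | hh)
        exacts [hh.1, hεr.le.trans hh]
    have hi := integrableOn_kernel_smul_sub hα hε0 hc.norm hL.norm x
    have hfarm : MeasurableSet {h : EuclideanSpace ℝ (Fin n) | R * t / 6 ≤ ‖h‖} :=
      measurable_norm measurableSet_Ici
    have hdisj : Disjoint {h : EuclideanSpace ℝ (Fin n) | ε ≤ ‖h‖ ∧ ‖h‖ < R * t / 6}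
        {h | R * t / 6 ≤ ‖h‖} :=
      Set.disjoint_left.2 fun h (h1 : ε ≤ ‖h‖ ∧ ‖h‖ < R * t / 6)
        (h2 : R * t / 6 ≤ ‖h‖) => not_lt.2 h2 h1.2
    simp only [smul_eq_mul] at hi
    rw [hunion] at hi ⊢
    rw [setIntegral_union hdisj hfarm (hi.mono_set Set.subset_union_left)
      (hi.mono_set Set.subset_union_right)]
    linarith [hnear ε hε0]
  have hN' : N = C * (n * V / (2 - α)) * (1 / 6 : ℝ) ^ (2 - α) * (‖u x‖ - 1) *
      (R * t) ^ (-α) := by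
    rw [hN, show R * t / 6 = 1 / 6 * (R * t) by ring,
      Real.mul_rpow (by norm_num) hd.le, show (2 : ℝ) - α = 2 + -α by ring,
      Real.rpow_add hd, Real.rpow_two]
    field_simp
  have hP' : P = (n * V / (n + 2 * α) + I) / 2 * (1 / 6 : ℝ) ^ (-((n : ℝ) / 2 + α)) *
      (R * t) ^ (-((n : ℝ) / 2 + α)) := by
    rw [hP, show R * t / 6 = 1 / 6 * (R * t) by ring, Real.mul_rpow (by norm_num) hd.le]
    ring
  have hsq : (‖u x‖ - 1) ^ 2 ≤ -(‖u x‖ * (1 - ‖u x‖ ^ 2)) := by nlinarith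
  calc (‖u x‖ - 1) ^ 2 ≤ fracConst n α * N + fracConst n α * P := by linarith
    _ = _ := by rw [hN', hP']; ring

theorem IsGinzburgLandauSolution.norm_le_one {n : ℕ} [NeZero n] {F : Type*}
    [NormedAddCommGroup F] [InnerProductSpace ℝ F] [CompleteSpace F] {α : ℝ} (hα : 0 < α)
    (hα2 : α < 2) {u : EuclideanSpace ℝ (Fin n) → F} (hc : Continuous u) (hL : MemLAlpha α u)
    (hu : IsGinzburgLandauSolution α u)
    (hint : Integrable (fun x => (1 - ‖u x‖ ^ 2) ^ 2)) (x₀ : EuclideanSpace ℝ (Fin n)) :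
    ‖u x₀‖ ≤ 1 := by
  by_contra! hx₀
  obtain ⟨C₁, C₂, hC₁, hC₂, hC⟩ :=
    hu.exists_sq_le_at_weighted_max hα hα2 hc hL hint (n + 2)
  set a := ‖u x₀‖ - 1 with ha
  have ha0 : 0 < a := by linarith
  suffices h : ∀ R : ℝ, 1 ≤ R → a ≤ R ^ (-α) * (C₁ + C₂ / a) by
    have hlim : Tendsto (fun R : ℝ => R ^ (-α) * (C₁ + C₂ / a)) atTop (𝓝 0) := by
      simpa using (tendsto_rpow_neg_atTop hα).mul_const (C₁ + C₂ / a)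
    exact ha0.not_ge (ge_of_tendsto hlim ((eventually_ge_atTop 1).mono h))
  intro R hR
  have hR0 : 0 < R := by linarith
  obtain ⟨x, hxB, hxmax⟩ := (isCompact_closedBall x₀ R).exists_isMaxOn
    ⟨x₀, Metric.mem_closedBall_self hR0.le⟩
    (f := fun y => (‖u y‖ - 1) * (1 - ‖y - x₀‖ ^ 2 / R ^ 2) ^ (n + 2))
    (Continuous.continuousOn (by fun_prop))
  have hmax0 : a ≤ (‖u x‖ - 1) * (1 - ‖x - x₀‖ ^ 2 / R ^ 2) ^ (n + 2) := by
    simpa [ha] using hxmax (Metric.mem_closedBall_self hR0.le)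
  have ht_nonneg : 0 ≤ 1 - ‖x - x₀‖ ^ 2 / R ^ 2 := by
    rw [mem_closedBall_iff_norm] at hxB
    rw [sub_nonneg, div_le_one (by positivity)]
    gcongr
  have ht1 : 1 - ‖x - x₀‖ ^ 2 / R ^ 2 ≤ 1 := sub_le_self _ (by positivity)
  obtain ⟨t, ht⟩ : ∃ t, t = 1 - ‖x - x₀‖ ^ 2 / R ^ 2 := ⟨_, rfl⟩
  rw [← ht] at hmax0 ht_nonneg ht1
  -- The weight vanishes on the sphere, where the weighted value would be `0 < a`.
  have ht0 : 0 < t := ht_nonneg.lt_of_ne fun h => by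
    rw [← h, zero_pow (by omega), mul_zero] at hmax0
    linarith
  have hm : 0 < ‖u x‖ - 1 := pos_of_mul_pos_left (ha0.trans_le hmax0) (by positivity)
  have key := hC R t x₀ x hR0 ht ht0 (by linarith) fun y hy => by
    rw [ht]
    refine hxmax ?_
    rw [mem_closedBall_iff_norm]
    rw [sub_pos, div_lt_one (by positivity)] at hy
    exact (lt_of_pow_lt_pow_left₀ 2 hR0.le hy).le
  set m := ‖u x‖ - 1 with hm_def
  have hn0 : (0 : ℝ) ≤ n := n.cast_nonneg
  -- The exponent `n + 2` is large enough: `α ≤ n + 2` and `n / 2 + α ≤ 2 (n + 2)`.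
  have e1 : t ^ (n + 2) * (R * t) ^ (-α) ≤ R ^ (-α) :=
    pow_mul_rpow_neg_le ht0 ht1 hR (by push_cast; linarith) le_rfl
  have e2 : t ^ (2 * (n + 2)) * (R * t) ^ (-((n : ℝ) / 2 + α)) ≤ R ^ (-α) :=
    pow_mul_rpow_neg_le ht0 ht1 hR (by push_cast; linarith) (by linarith)
  set X := m * t ^ (n + 2) with hX
  have hX0 : 0 < X := ha0.trans_le hmax0
  have hXX : X * X ≤ C₁ * X * R ^ (-α) + C₂ * R ^ (-α) := by
    calc X * X = m ^ 2 * t ^ (2 * (n + 2)) := by rw [hX]; ring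
      _ ≤ (C₁ * m * (R * t) ^ (-α) + C₂ * (R * t) ^ (-((n : ℝ) / 2 + α))) *
          t ^ (2 * (n + 2)) := by gcongr
      _ = C₁ * X * (t ^ (n + 2) * (R * t) ^ (-α)) +
          C₂ * (t ^ (2 * (n + 2)) * (R * t) ^ (-((n : ℝ) / 2 + α))) := by rw [hX]; ring
      _ ≤ _ := by gcongr
  calc a ≤ X := hmax0
    _ ≤ (C₁ * X * R ^ (-α) + C₂ * R ^ (-α)) / X := (le_div_iff₀ hX0).2 hXX
    _ = R ^ (-α) * (C₁ + C₂ / X) := by field_simp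
    _ ≤ _ := by gcongr

theorem theorem1p1 (n : ℕ) {F : Type*} [NormedAddCommGroup F] [InnerProductSpace ℝ F]
    [FiniteDimensional ℝ F] (α : ℝ) (hα0 : 0 < α) (hα2 : α < 2)
    (u : EuclideanSpace ℝ (Fin n) → F) (huE : MemE α u)
    (hu : IsGinzburgLandauSolution α u)
    (hint : Integrable (fun x => (1 - ‖u x‖ ^ 2) ^ 2) volume) :
    ∀ x, ‖u x‖ ≤ 1 := by
  intro x
  rcases eq_or_ne n 0 with rfl | hn
  -- In dimension zero the space is one point and the operator vanishes, so the equation itself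
  -- forces `u x = 0` or `‖u x‖ = 1`.
  · have h0 : ∀ ε : ℝ, truncFracLaplacian α ε u x = 0 := fun ε => by
      simp [truncFracLaplacian, Subsingleton.elim _ x]
    have h1 : (1 - ‖u x‖ ^ 2) • u x = 0 :=
      tendsto_nhds_unique (hu x) (by simpa only [h0] using tendsto_const_nhds)
    rcases smul_eq_zero.1 h1 with h2 | h2
    · nlinarith [norm_nonneg (u x)]
    · simp [h2]
  · have : NeZero n := ⟨hn⟩
    have : CompleteSpace F := FiniteDimensional.complete ℝ F
    exact hu.norm_le_one hα0 hα2 huE.1.1.continuous huE.2 hint x
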